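/- All Hilbert spaces are complex, nonzero and finite-dimensional, and a state is a positive semidefinite operator of trace one. A state $\rho$ of a system with parties $1,\dots,N$ is called $k$-UDA (uniquely determined among all states by its $k$-partite marginals) if the only state $\sigma$ of the same system with $\operatorname{tr}_{S^c}\sigma=\operatorname{tr}_{S^c}\rho$ for every set $S$ of exactly $k$ parties is $\sigma=\rho$. For $N\ge 2$, $\rho$ is called genuinely (multipartite) entangled if it is not a convex combination of pure states $|\varphi\rangle\langle\varphi|$ each of which is a product state with respect to some bipartition of the parties into two nonempty sets (the bipartition may vary with the term). Let $k,m,n$ be positive integers with $m,n\ge 2$. Let $\alpha$ be a state of the $m$-partite system $(A_1,\dots,A_m)$ and $\beta$ a state of the $n$-partite system $(B_1,\dots,B_n)$. Suppose that $\alpha$ and $\beta$ are both $k$-UDA and both genuinely entangled, and that at least one of them is pure. Then the following hold. (i) Let $\alpha\otimes_K\beta$ be the state $\alpha\otimes\beta$ regarded as a state of the system $(C_1,\dots,C_{\max\{m,n\}})$, where $C_j=A_jB_j$ for $j\le\min\{m,n\}$ and, for $j>\min\{m,n\}$, $C_j$ is whichever of $A_j$, $B_j$ exists. Then $\alpha\otimes_K\beta$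 is a $\max\{m,n\}$-partite genuinely entangled $k$-UDA state. (ii) For every integer $\ell$ with $1\le\ell<\min\{m,n\}$, let $\alpha\otimes_{K_c}\beta$ be the state $\alpha\otimes\beta$ regarded as a state of the system $(A_1B_1,\dots,A_\ell B_\ell,A_{\ell+1},\dots,A_m,B_{\ell+1},\dots,B_n)$. Then $\alpha\otimes_{K_c}\beta$ is an $(m+n-\ell)$-partite genuinely entangled $k$-UDA state. -/

import Mathlib

/-!
Multipartite states in coordinates.  A system with finite party set `ι` has, for each party `i`,
a finite type `H i` labelling an orthonormal basis of the local Hilbert space `ℂ^(H i)`.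
The global space `⨂ i, ℂ^(H i)` has the product basis `∀ i, H i`; vectors are coordinate
functions on it and operators are matrices over it.
-/

universe u

open scoped ComplexOrder

namespace Multipartite

section Basics

variable {ι : Type} {H : ι → Type u}

/-- The rank-one operator `|ψ⟩⟨ψ|`. -/
def proj {d : Type u} (ψ : d → ℂ) : Matrix d d ℂ := Matrix.vecMulVec ψ (star ψ)

/-- A (pure or mixed) state: a positive semidefinite matrix of trace one. -/
def IsState [Fintype ι] [DecidableEq ι] [∀ i, Fintype (H i)]
    (ρ : Matrix (∀ i, H i) (∀ i, H i) ℂ) : Prop :=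
  ρ.PosSemidef ∧ ρ.trace = 1

/-- A pure state: a state of the form `|ψ⟩⟨ψ|` (the trace condition makes `ψ` a unit vector). -/
def IsPure [Fintype ι] [DecidableEq ι] [∀ i, Fintype (H i)]
    (ρ : Matrix (∀ i, H i) (∀ i, H i) ℂ) : Prop :=
  IsState ρ ∧ ∃ ψ : (∀ i, H i) → ℂ, ρ = proj ψ

/-- The basis index of the global system with `S`-part `x` and `Sᶜ`-part `z`. -/
def glue [DecidableEq ι] (S : Finset ι) (x : ∀ i : {i // i ∈ S}, H i)
    (z : ∀ i : {i // i ∉ S}, H i) : ∀ i, H i :=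
  fun i => if h : i ∈ S then x ⟨i, h⟩ else z ⟨i, h⟩

/-- The marginal `ρ_S = tr_{Sᶜ} ρ` on the parties in `S` (partial trace over all others). -/
def marginal [Fintype ι] [DecidableEq ι] [∀ i, Fintype (H i)] (S : Finset ι)
    (ρ : Matrix (∀ i, H i) (∀ i, H i) ℂ) :
    Matrix (∀ i : {i // i ∈ S}, H i) (∀ i : {i // i ∈ S}, H i) ℂ :=
  Matrix.of fun x y => ∑ z : (∀ i : {i // i ∉ S}, H i), ρ (glue S x z) (glue S y z)

/-- `ρ` is `k`-uniquely determined among all states: no other state, pure or mixed, has all the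
same `k`-partite marginals. -/
def IsUDA [Fintype ι] [DecidableEq ι] [∀ i, Fintype (H i)] (k : ℕ)
    (ρ : Matrix (∀ i, H i) (∀ i, H i) ℂ) : Prop :=
  IsState ρ ∧ ∀ σ : Matrix (∀ i, H i) (∀ i, H i) ℂ, IsState σ →
    (∀ S : Finset ι, S.card = k → marginal S σ = marginal S ρ) → σ = ρ

/-- `φ` is a biproduct vector: `φ = u ⊗ v` for some `u` on the parties in `S` and `v` on the
remaining parties, where both sides of the bipartition `S | Sᶜ` are nonempty. -/
def IsBiproduct (φ : (∀ i, H i) → ℂ) : Prop :=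
  ∃ S : Finset ι, S.Nonempty ∧ (∃ i, i ∉ S) ∧
    ∃ (u : (∀ i : {i // i ∈ S}, H i) → ℂ) (v : (∀ i : {i // i ∉ S}, H i) → ℂ),
      ∀ x, φ x = u (fun i => x i) * v (fun i => x i)

/-- Biseparable states: convex mixtures of pure biproduct states, where different terms may be
product across different bipartitions. -/
def biseparable (H : ι → Type u) [Fintype ι] [DecidableEq ι] [∀ i, Fintype (H i)] :
    Set (Matrix (∀ i, H i) (∀ i, H i) ℂ) :=
  convexHull ℝ {ρ | IsState ρ ∧ ∃ φ : (∀ i, H i) → ℂ, IsBiproduct φ ∧ ρ = proj φ}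

/-- Genuinely multipartite entangled: a state of at least two parties that is not biseparable. -/
def IsGenuinelyEntangled [Fintype ι] [DecidableEq ι] [∀ i, Fintype (H i)]
    (ρ : Matrix (∀ i, H i) (∀ i, H i) ℂ) : Prop :=
  2 ≤ Fintype.card ι ∧ IsState ρ ∧ ρ ∉ biseparable H

end Basics

section Products

variable {ι κ : Type}

/-- The local bases of all parties of two systems taken together. -/
def Joint (A : ι → Type u) (B : κ → Type u) : ι ⊕ κ → Type u
  | .inl i => A i
  | .inr j => B j

instance (A : ι → Type u) (B : κ → Type u) [∀ i, Fintype (A i)] [∀ j, Fintype (B j)] :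
    ∀ x, Fintype (Joint A B x)
  | .inl i => inferInstanceAs (Fintype (A i))
  | .inr j => inferInstanceAs (Fintype (B j))

/-- The tensor product `α ⊗ β`, a matrix on the system of all parties of `α` and of `β`. -/
def tensor {A : ι → Type u} {B : κ → Type u} (α : Matrix (∀ i, A i) (∀ i, A i) ℂ)
    (β : Matrix (∀ j, B j) (∀ j, B j) ℂ) :
    Matrix (∀ x, Joint A B x) (∀ x, Joint A B x) ℂ :=
  Matrix.of fun x y =>
    α (fun i => x (.inl i)) (fun i => y (.inl i)) * β (fun j => x (.inr j)) (fun j => y (.inr j))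

/-- Composing parties: if the party `t : τ` is handed over to the composite party `f t`, then
the local space of the composite party `p` is the tensor product of the spaces of all `t` with
`f t = p`; this is its product basis. -/
abbrev Merged {τ π : Type} (f : τ → π) (H : τ → Type u) (p : π) : Type u :=
  ∀ t : {t // f t = p}, H t

/-- The same operator, regarded as an operator of the composite parties. -/
def merge {τ π : Type} (f : τ → π) {H : τ → Type u} (ρ : Matrix (∀ t, H t) (∀ t, H t) ℂ) :
    Matrix (∀ p, Merged f H p) (∀ p, Merged f H p) ℂ :=
  Matrix.of fun x y => ρ (fun t => x (f t) ⟨t, rfl⟩) (fun t => y (f t) ⟨t, rfl⟩)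

variable {m n : ℕ}

/-- The parties of the Kronecker product: `A_j` and `B_j` both go to the `j`-th party, so that
`C_j = A_j B_j` for `j` below `min m n`, and `C_j` is the single remaining `A_j` or `B_j`
otherwise. -/
def kronParty (m n : ℕ) : Fin m ⊕ Fin n → Fin (max m n)
  | .inl i => Fin.castLE (le_max_left m n) i
  | .inr j => Fin.castLE (le_max_right m n) j

/-- The Kronecker product `α ⊗_K β`, a matrix on a system of `max m n` parties. -/
def kron {A : Fin m → Type u} {B : Fin n → Type u} (α : Matrix (∀ i, A i) (∀ i, A i) ℂ)
    (β : Matrix (∀ j, B j) (∀ j, B j) ℂ) :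
    Matrix (∀ p, Merged (kronParty m n) (Joint A B) p)
      (∀ p, Merged (kronParty m n) (Joint A B) p) ℂ :=
  merge (kronParty m n) (tensor α β)

/-- The parties of the `K_c`-product, in the order
`(A_1 B_1), …, (A_ℓ B_ℓ), A_{ℓ+1}, …, A_m, B_{ℓ+1}, …, B_n`. -/
def kcParty (m n l : ℕ) (h : l < min m n) : Fin m ⊕ Fin n → Fin (m + n - l)
  | .inl i => ⟨i, by omega⟩
  | .inr j => if (j : ℕ) < l then ⟨j, by omega⟩ else ⟨m + (j - l), by omega⟩

/-- The `K_c`-product `α ⊗_{K_c} β` that composes the first `l` parties of both systems, a matrix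
on a system of `m + n - l` parties. -/
def kc {A : Fin m → Type u} {B : Fin n → Type u} (l : ℕ) (h : l < min m n)
    (α : Matrix (∀ i, A i) (∀ i, A i) ℂ) (β : Matrix (∀ j, B j) (∀ j, B j) ℂ) :
    Matrix (∀ p, Merged (kcParty m n l h) (Joint A B) p)
      (∀ p, Merged (kcParty m n l h) (Joint A B) p) ℂ :=
  merge (kcParty m n l h) (tensor α β)

end Products

end Multipartite

/-! By symmetry let `α = |a⟩⟨a|` be the pure factor. Everything rests on one rigidity fact: a
positive operator whose `A`-marginal is `|a⟩⟨a|` equals `|a⟩⟨a|` tensored with its `B`-marginal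
(`eq_mul_of_sum_mul_star_eq`, `apply_eq_of_traceRight_eq_proj`).

UDA: let `σ` share the `k`-marginals of `α ⊗ β`. No two parties of `A` are composed together, so `k`
parties of `A` lie in `k` composite parties, and `tr_B σ` has the `k`-marginals of `α`. Hence `tr_B
σ = α`, likewise `tr_A σ = β`, and rigidity gives `σ = α ⊗ β`.

Entanglement: if `α ⊗ β` is a mixture of biproduct vectors `φ`, rigidity forces `φ = a ⊗ b` for
every term of nonzero weight. The cut of `φ` must split the parties of `A` or those of `B`, because
the two systems overlap in a composite party (`isBiproduct_or`). It cannot split those of `A`, as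
`a` would then be biproduct; so each `b` is biproduct and `β` is biseparable, a contradiction.

Both products are handled at once through `Composition`, which records only how parties are grouped.
-/

namespace Multipartite

/-! ### Rigidity of pure marginals -/

section PureMarginals

variable {X Y Z K : Type*}

/-- If a sum of rank-one operators is the projection on the unit vector `a`, then every summand is
supported on the line of `a`. -/
theorem eq_mul_of_sum_mul_star_eq [Fintype X] [Fintype K] {a : X → ℂ} (ha : ∑ x, a x * star (a x) = 1) {r : K → X → ℂ}
    (h : ∀ x x', ∑ k, r k x * star (r k x') = a x * star (a x')) (k : K) (x : X) :
    r k x = a x * ∑ x', star (a x') * r k x' := by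
  set s : K → ℂ := fun k => ∑ x', star (a x') * r k x' with hs
  have hstar : ∀ k, star (s k) = ∑ x, a x * star (r k x) := fun k => by
    simp [hs, star_sum, mul_comm]
  -- Pythagoras with `s k = ⟨a, r k⟩`. Summed over `k`, both terms on the right equal 1: the trace
  -- of `|a⟩⟨a|` and its expectation in `a`. So all residuals vanish.
  have hd : ∀ k, ∑ x, (r k x - a x * s k) * star (r k x - a x * s k) =
      ∑ x, r k x * star (r k x) - s k * star (s k) := fun k => by
    have h1 : ∑ x, r k x * (star (a x) * star (s k)) = s k * star (s k) := by
      rw [hs, Finset.sum_mul]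
      exact Finset.sum_congr rfl fun x _ => by ring
    have h2 : ∑ x, a x * s k * star (r k x) = s k * star (s k) := by
      rw [hstar, Finset.mul_sum]
      exact Finset.sum_congr rfl fun x _ => by ring
    have h3 : ∑ x, a x * s k * (star (a x) * star (s k)) = s k * star (s k) := by
      calc _ = ∑ x, (a x * star (a x)) * (s k * star (s k)) :=
            Finset.sum_congr rfl fun x _ => by ring
        _ = _ := by rw [← Finset.sum_mul, ha, one_mul]
    simp only [star_sub, star_mul', sub_mul, mul_sub, Finset.sum_sub_distrib, h1, h2, h3]
    ring
  have hr : ∑ k, ∑ x, r k x * star (r k x) = 1 := by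
    rw [Finset.sum_comm, ← ha]
    exact Finset.sum_congr rfl fun x _ => h x x
  have hss : ∑ k, s k * star (s k) = 1 := by
    calc ∑ k, s k * star (s k)
        = ∑ k, ∑ x, ∑ x', (star (a x) * a x') * (r k x * star (r k x')) := by
          refine Finset.sum_congr rfl fun k _ => ?_
          rw [hstar, hs, Finset.sum_mul_sum]
          exact Finset.sum_congr rfl fun x _ => Finset.sum_congr rfl fun x' _ => by ring
      _ = ∑ x, ∑ x', (star (a x) * a x') * ∑ k, (r k x * star (r k x')) := by
          rw [Finset.sum_comm]
          refine Finset.sum_congr rfl fun x _ => ?_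
          rw [Finset.sum_comm]
          exact Finset.sum_congr rfl fun x' _ => (Finset.mul_sum ..).symm
      _ = (∑ x, a x * star (a x)) * ∑ x', a x' * star (a x') := by
          rw [Finset.sum_mul_sum]
          refine Finset.sum_congr rfl fun x _ => Finset.sum_congr rfl fun x' _ => ?_
          rw [h]
          ring
      _ = 1 := by rw [ha, one_mul]
  have h0 : ∑ k, ∑ x, (r k x - a x * s k) * star (r k x - a x * s k) = 0 := by
    simp only [hd, Finset.sum_sub_distrib, hr, hss, sub_self]
  have hk := (Finset.sum_eq_zero_iff_of_nonneg fun k _ =>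
    Finset.sum_nonneg fun x _ => mul_star_self_nonneg _).1 h0 k (Finset.mem_univ k)
  have hx := (Finset.sum_eq_zero_iff_of_nonneg fun x _ => mul_star_self_nonneg _).1 hk x
    (Finset.mem_univ x)
  rcases mul_eq_zero.1 hx with h' | h'
  · exact sub_eq_zero.1 h'
  · exact sub_eq_zero.1 (star_eq_zero.1 h')

/-- The partial trace over the second factor of a decomposition of the basis as a product. -/
def traceRight [Fintype Y] (e : Z ≃ X × Y) (σ : Matrix Z Z ℂ) : Matrix X X ℂ :=
  Matrix.of fun x x' => ∑ y, σ (e.symm (x, y)) (e.symm (x', y))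

/-- The partial trace over the first factor of a decomposition of the basis as a product. -/
def traceLeft [Fintype X] (e : Z ≃ X × Y) (σ : Matrix Z Z ℂ) : Matrix Y Y ℂ :=
  traceRight (e.trans (Equiv.prodComm X Y)) σ

theorem traceLeft_apply [Fintype X] (e : Z ≃ X × Y) (σ : Matrix Z Z ℂ) (y y' : Y) :
    traceLeft e σ y y' = ∑ x, σ (e.symm (x, y)) (e.symm (x, y')) := rfl

theorem posSemidef_traceRight [Fintype Y] (e : Z ≃ X × Y) {σ : Matrix Z Z ℂ} (hσ : σ.PosSemidef) :
    (traceRight e σ).PosSemidef := by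
  have : traceRight e σ = ∑ y, σ.submatrix (fun x => e.symm (x, y)) fun x => e.symm (x, y) := by
    ext x x'
    simp [traceRight, Matrix.sum_apply]
  rw [this]
  exact Matrix.posSemidef_sum _ fun y _ => hσ.submatrix _

theorem trace_traceRight [Fintype X] [Fintype Y] [Fintype Z] (e : Z ≃ X × Y)
    (σ : Matrix Z Z ℂ) :
    (traceRight e σ).trace = σ.trace := by
  simp only [Matrix.trace, Matrix.diag_apply, traceRight, Matrix.of_apply]
  rw [← e.symm.sum_comp, Fintype.sum_prod_type]

theorem exists_eq_sum_mul_star [Fintype Z] {σ : Matrix Z Z ℂ} (hσ : σ.PosSemidef) :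
    ∃ r : Z → Z → ℂ, ∀ z z', σ z z' = ∑ k, r k z * star (r k z') := by
  classical
  open scoped MatrixOrder in
  obtain ⟨B, rfl⟩ := CStarAlgebra.nonneg_iff_eq_star_mul_self.mp hσ.nonneg
  exact ⟨fun k z => star (B k z), fun z z' => by
    simp [Matrix.star_eq_conjTranspose, Matrix.mul_apply]⟩

/-- A positive semidefinite operator with a pure marginal is a tensor product. -/
theorem apply_eq_of_traceRight_eq_proj {X Z : Type u} [Fintype X] [Fintype Y] [Fintype Z]
    (e : Z ≃ X × Y) {σ : Matrix Z Z ℂ} (hσ : σ.PosSemidef) {a : X → ℂ} (ha : ∑ x, a x * star (a x) = 1)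
    (h : traceRight e σ = proj a) (x x' : X) (y y' : Y) :
    σ (e.symm (x, y)) (e.symm (x', y')) = proj a x x' * traceLeft e σ y y' := by
  obtain ⟨r, hr⟩ := exists_eq_sum_mul_star hσ
  -- Slicing each rank-one term of `σ` at each `y` turns the partial trace into a sum of rank-one
  -- operators on `X`.
  have key := eq_mul_of_sum_mul_star_eq (K := Z × Y) ha
    (r := fun k x => r k.1 (e.symm (x, k.2))) fun x x' => by
      have := congrFun (congrFun h x) x'
      simp only [traceRight, Matrix.of_apply, hr, proj, Matrix.vecMulVec_apply, Pi.star_apply]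
        at this
      rw [← this, Fintype.sum_prod_type, Finset.sum_comm]
  choose n hn using show ∃ n : Z → Y → ℂ, ∀ k x y, r k (e.symm (x, y)) = a x * n k y from
    ⟨fun k y => _, fun k x y => key (k, y) x⟩
  rw [traceLeft_apply]
  simp only [hr, hn, proj, Matrix.vecMulVec_apply, Pi.star_apply, star_mul']
  have : ∑ x, ∑ k, a x * n k y * (star (a x) * star (n k y')) = ∑ k, n k y * star (n k y') := by
    calc _ = (∑ x, a x * star (a x)) * ∑ k, n k y * star (n k y') := by
          rw [Finset.sum_mul_sum]
          exact Finset.sum_congr rfl fun x _ => Finset.sum_congr rfl fun k _ => by ring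
      _ = _ := by rw [ha, one_mul]
  rw [this, Finset.mul_sum]
  exact Finset.sum_congr rfl fun k _ => by ring

end PureMarginals

/-! ### Marginals as expectations of local operators -/

section LocalTests

variable {ι : Type} {H : ι → Type u}

/-- The matrix is an operator of the parties in `S`, tensored with the identity elsewhere. -/
def IsLocal (S : Finset ι) (E : Matrix (∀ i, H i) (∀ i, H i) ℂ) : Prop :=
  (∀ w w', E w w' ≠ 0 → ∀ i ∉ S, w i = w' i) ∧
    ∀ v v' w w', (∀ i ∈ S, v i = w i) → (∀ i ∈ S, v' i = w' i) → (∀ i ∉ S, v i = v' i) →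
      (∀ i ∉ S, w i = w' i) → E v v' = E w w'

variable [DecidableEq ι]

theorem glue_of_mem {S : Finset ι} (x : ∀ i : {i // i ∈ S}, H i) (z : ∀ i : {i // i ∉ S}, H i)
    {i : ι} (h : i ∈ S) : glue S x z i = x ⟨i, h⟩ := dif_pos h

theorem glue_of_notMem {S : Finset ι} (x : ∀ i : {i // i ∈ S}, H i)
    (z : ∀ i : {i // i ∉ S}, H i) {i : ι} (h : i ∉ S) : glue S x z i = z ⟨i, h⟩ := dif_neg h

theorem glue_restrict (S : Finset ι) (w : ∀ i, H i) :
    glue S (fun i => w i) (fun i => w i) = w := by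
  funext i
  by_cases h : i ∈ S
  · rw [glue_of_mem _ _ h]
  · rw [glue_of_notMem _ _ h]

variable [Fintype ι] [∀ i, Fintype (H i)]

theorem sum_glue {M : Type*} [AddCommMonoid M] (S : Finset ι) (F : (∀ i, H i) → M) :
    ∑ w, F w = ∑ x, ∑ z, F (glue S x z) := by
  rw [← (Equiv.piEquivPiSubtypeProd (· ∈ S) H).symm.sum_comp, Fintype.sum_prod_type]
  rfl

/-- A local operator is diagonal outside `S` and blind to the value there, so the outer sum
collapses to a partial trace. The index `z₀` only serves to read off the block of `E`. -/
theorem sum_isLocal_mul {S : Finset ι} {E : Matrix (∀ i, H i) (∀ i, H i) ℂ} (hE : IsLocal S E)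
    (z₀ : ∀ i : {i // i ∉ S}, H i) (ρ : Matrix (∀ i, H i) (∀ i, H i) ℂ) :
    ∑ w, ∑ w', E w w' * ρ w w' =
      ∑ x, ∑ x', E (glue S x z₀) (glue S x' z₀) * marginal S ρ x x' := by
  classical
  rw [sum_glue S]
  refine Finset.sum_congr rfl fun x _ => ?_
  simp_rw [sum_glue S (fun w' => E _ w' * ρ _ w')]
  rw [Finset.sum_comm]
  refine Finset.sum_congr rfl fun x' _ => ?_
  rw [marginal, Matrix.of_apply, Finset.mul_sum]
  refine Finset.sum_congr rfl fun z _ => ?_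
  rw [Finset.sum_eq_single z]
  · congr 1
    exact hE.2 _ _ _ _ (fun i hi => by simp only [glue_of_mem _ _ hi])
      (fun i hi => by simp only [glue_of_mem _ _ hi])
      (fun i hi => by simp only [glue_of_notMem _ _ hi])
      (fun i hi => by simp only [glue_of_notMem _ _ hi])
  · intro z' _ hz
    suffices E (glue S x z) (glue S x' z') = 0 by rw [this, zero_mul]
    by_contra h
    refine hz (funext fun i => ?_)
    have := hE.1 _ _ h i.1 i.2
    rw [glue_of_notMem _ _ i.2, glue_of_notMem _ _ i.2] at this
    exact this.symm
  · simp

/-- Two operators have the same marginal on `S` if and only if local tests on `S` do not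
distinguish them. -/
theorem marginal_eq_iff {S : Finset ι} {ρ σ : Matrix (∀ i, H i) (∀ i, H i) ℂ} :
    marginal S ρ = marginal S σ ↔ ∀ E : Matrix (∀ i, H i) (∀ i, H i) ℂ, IsLocal S E →
      ∑ w, ∑ w', E w w' * ρ w w' = ∑ w, ∑ w', E w w' * σ w w' := by
  classical
  -- Local bases may be empty; then no reference index exists and both sides hold trivially.
  by_cases hne : Nonempty (∀ i : {i // i ∉ S}, H i)
  · obtain ⟨z₀⟩ := hne
    refine ⟨fun h E hE => by rw [sum_isLocal_mul hE z₀, sum_isLocal_mul hE z₀, h], fun h => ?_⟩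
    ext x x'
    -- The matrix unit at `(x, x')` tensored with the identity: it tests a single entry of the
    -- marginal.
    let E : Matrix (∀ i, H i) (∀ i, H i) ℂ := Matrix.of fun w w' =>
      if ((fun i : {i // i ∈ S} => w i) = x ∧ (fun i : {i // i ∈ S} => w' i) = x') ∧
        ∀ i ∉ S, w i = w' i then 1 else 0
    have hE : IsLocal S E := by
      refine ⟨fun w w' hw => ?_, fun v v' w w' h1 h2 h3 h4 => ?_⟩
      · by_contra hc
        exact hw (if_neg fun h' => hc h'.2)
      · have e1 : (fun i : {i // i ∈ S} => v i) = fun i : {i // i ∈ S} => w i :=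
          funext fun i => h1 i i.2
        have e2 : (fun i : {i // i ∈ S} => v' i) = fun i : {i // i ∈ S} => w' i :=
          funext fun i => h2 i i.2
        simp only [E, Matrix.of_apply, e1, e2]
        exact if_congr (and_congr_right fun _ => ⟨fun _ => h4, fun _ => h3⟩) rfl rfl
    have hEg : ∀ y y', E (glue S y z₀) (glue S y' z₀) = if y = x ∧ y' = x' then 1 else 0 := by
      intro y y'
      have e : ∀ y, (fun i : {i // i ∈ S} => glue S y z₀ i) = y :=
        fun y => funext fun i => glue_of_mem _ _ i.2
      simp only [E, Matrix.of_apply, e]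
      refine if_congr (and_iff_left fun i hi => ?_) rfl rfl
      rw [glue_of_notMem _ _ hi, glue_of_notMem _ _ hi]
    have hsum : ∀ τ : Matrix (∀ i, H i) (∀ i, H i) ℂ,
        ∑ w, ∑ w', E w w' * τ w w' = marginal S τ x x' := by
      intro τ
      rw [sum_isLocal_mul hE z₀, Finset.sum_eq_single x, Finset.sum_eq_single x'] <;>
        simp +contextual [hEg]
    rw [← hsum, ← hsum, h E hE]
  · rw [not_nonempty_iff] at hne
    have : IsEmpty (∀ i, H i) := ⟨fun w => hne.elim fun i => w i⟩
    refine ⟨fun _ E _ => by simp, fun _ => ?_⟩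
    ext x x'
    simp [marginal]

end LocalTests

/-! ### Biproduct vectors -/

section Biproduct

variable {ι : Type} {H : ι → Type u} [DecidableEq ι]

/-- Factors defined on the full index set avoid restricted index types, so cuts can be transported
between systems. -/
theorem isBiproduct_iff {φ : (∀ i, H i) → ℂ} :
    IsBiproduct φ ↔ ∃ S : Finset ι, S.Nonempty ∧ (∃ i, i ∉ S) ∧ ∃ U V : (∀ i, H i) → ℂ,
      (∀ x x', (∀ i ∈ S, x i = x' i) → U x = U x') ∧
      (∀ x x', (∀ i ∉ S, x i = x' i) → V x = V x') ∧ ∀ x, φ x = U x * V x := by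
  constructor
  · rintro ⟨S, hS, hS', u, v, h⟩
    exact ⟨S, hS, hS', fun x => u fun i => x i, fun x => v fun i => x i,
      fun x x' hx => congrArg u (funext fun i => hx i i.2),
      fun x x' hx => congrArg v (funext fun i => hx i i.2), h⟩
  · rintro ⟨S, hS, hS', U, V, hU, hV, h⟩
    refine ⟨S, hS, hS', ?_⟩
    by_cases hne : Nonempty (∀ i, H i)
    · obtain ⟨x₀⟩ := hne
      refine ⟨fun x => U (glue S x fun i => x₀ i), fun z => V (glue S (fun i => x₀ i) z),
        fun x => ?_⟩
      rw [h x]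
      congr 1
      · exact hU _ _ fun i hi => by rw [glue_of_mem _ _ hi]
      · exact hV _ _ fun i hi => by rw [glue_of_notMem _ _ hi]
    · exact ⟨0, 0, fun x => (hne ⟨x⟩).elim⟩

end Biproduct

end Multipartite


/-! ### Composing two systems -/

namespace Multipartite

/-- The system `C` arises from the systems `A` and `B` by handing the party `i` of `A` over to the
composite party `f i` and the party `j` of `B` over to the composite party `g j`. -/
structure Composition {ι κ π : Type} (f : ι → π) (g : κ → π) (A : ι → Type u) (B : κ → Type u)
    (C : π → Type u) where
  /-- The product basis of the composite system. -/
  equiv : (∀ p, C p) ≃ (∀ i, A i) × (∀ j, B j)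
  apply_eq_iff : ∀ (z z' : ∀ p, C p) (p : π), z p = z' p ↔
    (∀ i, f i = p → (equiv z).1 i = (equiv z').1 i) ∧
      ∀ j, g j = p → (equiv z).2 j = (equiv z').2 j

namespace Composition

variable {ι κ π : Type} {f : ι → π} {g : κ → π} {A : ι → Type u} {B : κ → Type u}
  {C : π → Type u} (e : Composition f g A B C)

/-- The composition with the roles of the two systems exchanged. -/
def symm : Composition g f B A C where
  equiv := e.equiv.trans (Equiv.prodComm _ _)
  apply_eq_iff z z' p := (e.apply_eq_iff z z' p).trans and_comm

/-- The tensor product, as an operator of the composite system. -/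
def tensor (α : Matrix (∀ i, A i) (∀ i, A i) ℂ) (β : Matrix (∀ j, B j) (∀ j, B j) ℂ) :
    Matrix (∀ p, C p) (∀ p, C p) ℂ :=
  Matrix.of fun z z' => α (e.equiv z).1 (e.equiv z').1 * β (e.equiv z).2 (e.equiv z').2

theorem symm_tensor (α : Matrix (∀ i, A i) (∀ i, A i) ℂ) (β : Matrix (∀ j, B j) (∀ j, B j) ℂ) :
    e.symm.tensor β α = e.tensor α β := by
  ext z z'
  exact mul_comm _ _

theorem fst_eq {z z' : ∀ p, C p} {i : ι} (h : z (f i) = z' (f i)) :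
    (e.equiv z).1 i = (e.equiv z').1 i := ((e.apply_eq_iff z z' _).1 h).1 i rfl

theorem snd_eq {z z' : ∀ p, C p} {j : κ} (h : z (g j) = z' (g j)) :
    (e.equiv z).2 j = (e.equiv z').2 j := ((e.apply_eq_iff z z' _).1 h).2 j rfl

theorem traceRight_tensor [Fintype (∀ j, B j)] {α : Matrix (∀ i, A i) (∀ i, A i) ℂ}
    {β : Matrix (∀ j, B j) (∀ j, B j) ℂ} (hβ : β.trace = 1) :
    traceRight e.equiv (e.tensor α β) = α := by
  ext x x'
  simp only [traceRight, tensor, Matrix.of_apply, Equiv.apply_symm_apply]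
  rw [← Finset.mul_sum]
  exact (congrArg _ hβ).trans (mul_one _)

/-- Local tests of one of the systems are local tests of the composite system. -/
theorem isLocal_lift [DecidableEq π] (hf : Function.Injective f) {S : Finset ι}
    {E : Matrix (∀ i, A i) (∀ i, A i) ℂ} (hE : IsLocal S E) [DecidableEq (∀ j, B j)] :
    IsLocal (S.image f) (Matrix.of fun z z' : ∀ p, C p =>
      if (e.equiv z).2 = (e.equiv z').2 then E (e.equiv z).1 (e.equiv z').1 else 0) := by
  constructor
  · intro w w' h p hp
    have h' : (e.equiv w).2 = (e.equiv w').2 ∧ E (e.equiv w).1 (e.equiv w').1 ≠ 0 := by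
      simpa using h
    refine (e.apply_eq_iff w w' p).2 ⟨?_, fun j _ => congrFun h'.1 j⟩
    rintro i rfl
    exact hE.1 _ _ h'.2 i fun hi => hp (Finset.mem_image_of_mem f hi)
  · intro v v' w w' h1 h2 h3 h4
    have hiff : (e.equiv v).2 = (e.equiv v').2 ↔ (e.equiv w).2 = (e.equiv w').2 := by
      simp only [funext_iff]
      refine forall_congr' fun j => ?_
      by_cases hj : g j ∈ S.image f
      · rw [e.snd_eq (h1 _ hj), e.snd_eq (h2 _ hj)]
      · exact iff_of_true (e.snd_eq (h3 _ hj)) (e.snd_eq (h4 _ hj))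
    have hEE : E (e.equiv v).1 (e.equiv v').1 = E (e.equiv w).1 (e.equiv w').1 :=
      hE.2 _ _ _ _ (fun i hi => e.fst_eq (h1 _ (Finset.mem_image_of_mem f hi)))
        (fun i hi => e.fst_eq (h2 _ (Finset.mem_image_of_mem f hi)))
        (fun i hi => e.fst_eq (h3 _ (hf.mem_finset_image.not.2 hi)))
        (fun i hi => e.fst_eq (h4 _ (hf.mem_finset_image.not.2 hi)))
    exact if_congr hiff hEE rfl

/-- A product vector that factors across a cut of the composite parties has a left factor that
factors across the induced cut, if the latter is nontrivial. -/
theorem isBiproduct_left [Fintype ι] [DecidableEq ι] [DecidableEq π] {S : Finset π} {U V : (∀ p, C p) → ℂ}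
    (hU : ∀ z z', (∀ p ∈ S, z p = z' p) → U z = U z')
    (hV : ∀ z z', (∀ p ∉ S, z p = z' p) → V z = V z') {a : (∀ i, A i) → ℂ} {b : (∀ j, B j) → ℂ}
    (h : ∀ x y, a x * b y = U (e.equiv.symm (x, y)) * V (e.equiv.symm (x, y)))
    (hb : ∃ y, b y ≠ 0) (h1 : ∃ i, f i ∈ S) (h2 : ∃ i, f i ∉ S) : IsBiproduct a := by
  obtain ⟨y, hy⟩ := hb
  have hz : ∀ (x x' : ∀ i, A i) (p : π), (∀ i, f i = p → x i = x' i) →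
      e.equiv.symm (x, y) p = e.equiv.symm (x', y) p := fun x x' p hp =>
    (e.apply_eq_iff _ _ p).2 ⟨by simpa using hp, by simp⟩
  -- Freeze the `B`-index at a `y` with `b y ≠ 0` and divide that constant out of one factor.
  refine isBiproduct_iff.2 ⟨Finset.univ.filter (f · ∈ S), ?_, ?_, fun x => U (e.equiv.symm (x, y)),
    fun x => V (e.equiv.symm (x, y)) / b y, fun x x' hx => hU _ _ fun p hp => hz _ _ _ ?_,
    fun x x' hx => ?_, fun x => ?_⟩
  · obtain ⟨i, hi⟩ := h1
    exact ⟨i, by simpa using hi⟩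
  · obtain ⟨i, hi⟩ := h2
    exact ⟨i, by simpa using hi⟩
  · rintro i rfl
    exact hx i (by simpa using hp)
  · have : V (e.equiv.symm (x, y)) = V (e.equiv.symm (x', y)) := by
      refine hV _ _ fun p hp => hz _ _ _ ?_
      rintro i rfl
      exact hx i (by simpa using hp)
    simp only [this]
  · rw [← mul_div_assoc, ← h, mul_div_cancel_right₀ _ hy]

theorem traceLeft_tensor [Fintype (∀ i, A i)] {α : Matrix (∀ i, A i) (∀ i, A i) ℂ}
    {β : Matrix (∀ j, B j) (∀ j, B j) ℂ} (hα : α.trace = 1) :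
    traceLeft e.equiv (e.tensor α β) = β := by
  rw [← symm_tensor]
  exact e.symm.traceRight_tensor hα

theorem isBiproduct_or [Fintype ι] [Fintype κ] [DecidableEq ι] [DecidableEq κ] [DecidableEq π]
    (hfg : ∀ p, (∃ i, f i = p) ∨ ∃ j, g j = p) (hov : ∃ i j, f i = g j)
    {φ : (∀ p, C p) → ℂ} (hφ : IsBiproduct φ) {a : (∀ i, A i) → ℂ} {b : (∀ j, B j) → ℂ}
    (h : ∀ x y, φ (e.equiv.symm (x, y)) = a x * b y) (ha : ∃ x, a x ≠ 0) (hb : ∃ y, b y ≠ 0) :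
    IsBiproduct a ∨ IsBiproduct b := by
  obtain ⟨S, ⟨p, hp⟩, ⟨q, hq⟩, U, V, hU, hV, hUV⟩ := isBiproduct_iff.1 hφ
  obtain ⟨i₀, j₀, hij⟩ := hov
  by_cases hA : (∃ i, f i ∈ S) ∧ ∃ i, f i ∉ S
  · exact .inl (e.isBiproduct_left hU hV (fun x y => by rw [← h, hUV]) hb hA.1 hA.2)
  by_cases hB : (∃ j, g j ∈ S) ∧ ∃ j, g j ∉ S
  · exact .inr (e.symm.isBiproduct_left hU hV
      (fun y x => (mul_comm _ _).trans ((h x y).symm.trans (hUV _))) ha hB.1 hB.2)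
  -- Now each system lies wholly on one side of the cut. The shared composite party puts both on the
  -- same side, and as they cover all parties the other side is empty.
  exfalso
  simp only [not_and, not_exists, not_not, forall_exists_index] at hA hB
  by_cases hi : f i₀ ∈ S
  · rcases hfg q with ⟨i, rfl⟩ | ⟨j, rfl⟩
    · exact hq (hA _ hi i)
    · exact hq (hB j₀ (hij ▸ hi) j)
  · rcases hfg p with ⟨i, rfl⟩ | ⟨j, rfl⟩
    · exact hi (hA _ hp i₀)
    · exact hi (hij ▸ hB _ hp j₀)

variable [Fintype ι] [Fintype κ] [Fintype π] [DecidableEq ι] [DecidableEq κ] [DecidableEq π]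
  [∀ i, Fintype (A i)] [∀ j, Fintype (B j)] [∀ p, Fintype (C p)]
  {α : Matrix (∀ i, A i) (∀ i, A i) ℂ} {β : Matrix (∀ j, B j) (∀ j, B j) ℂ}

theorem isState_tensor (hα : IsState α) (hβ : IsState β) : IsState (e.tensor α β) := by
  refine ⟨(hα.1.kronecker hβ.1).submatrix e.equiv, ?_⟩
  rw [← trace_traceRight e.equiv, e.traceRight_tensor hβ.2, hα.2]

theorem isState_traceRight {σ : Matrix (∀ p, C p) (∀ p, C p) ℂ} (hσ : IsState σ) :
    IsState (traceRight e.equiv σ) :=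
  ⟨posSemidef_traceRight _ hσ.1, by rw [trace_traceRight, hσ.2]⟩

theorem sum_mul_traceRight [DecidableEq (∀ j, B j)] (E : Matrix (∀ i, A i) (∀ i, A i) ℂ)
    (σ : Matrix (∀ p, C p) (∀ p, C p) ℂ) :
    ∑ x, ∑ x', E x x' * traceRight e.equiv σ x x' = ∑ z, ∑ z', Matrix.of (fun z z' : ∀ p, C p =>
      if (e.equiv z).2 = (e.equiv z').2 then E (e.equiv z).1 (e.equiv z').1 else 0) z z' *
        σ z z' := by
  rw [← e.equiv.symm.sum_comp, Fintype.sum_prod_type]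
  refine Finset.sum_congr rfl fun x _ => ?_
  simp_rw [← e.equiv.symm.sum_comp (fun z' => Matrix.of _ _ z' * σ _ z'), Fintype.sum_prod_type]
  rw [Finset.sum_comm]
  refine Finset.sum_congr rfl fun x' _ => ?_
  simp [traceRight, Finset.mul_sum, ite_mul]

/-- A test `E` on `S` has the same expectation in the partial trace as `E ⊗ 1`, a test on `S.image
f`, has in the full operator. -/
theorem marginal_traceRight (hf : Function.Injective f) {S : Finset ι}
    {σ τ : Matrix (∀ p, C p) (∀ p, C p) ℂ}
    (h : marginal (S.image f) σ = marginal (S.image f) τ) :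
    marginal S (traceRight e.equiv σ) = marginal S (traceRight e.equiv τ) := by
  classical
  refine marginal_eq_iff.2 fun E hE => ?_
  rw [sum_mul_traceRight, sum_mul_traceRight]
  exact marginal_eq_iff.1 h _ (e.isLocal_lift hf hE)

theorem traceRight_eq_of_isUDA (hf : Function.Injective f) {k : ℕ} (hα : IsUDA k α)
    (hβ : IsState β) {σ : Matrix (∀ p, C p) (∀ p, C p) ℂ} (hσ : IsState σ)
    (h : ∀ P : Finset π, P.card = k → marginal P σ = marginal P (e.tensor α β)) :
    traceRight e.equiv σ = α := by
  refine hα.2 _ (e.isState_traceRight hσ) fun S hS => ?_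
  rw [e.marginal_traceRight hf (h (S.image f) (by rw [Finset.card_image_of_injective _ hf, hS])),
    e.traceRight_tensor hβ.2]

theorem sum_mul_star_eq_one {ψ : (∀ i, A i) → ℂ} (h : IsState (proj ψ)) :
    ∑ x, ψ x * star (ψ x) = 1 := h.2

/-! ### Unique determination and genuine entanglement of the product -/

theorem isUDA_tensor_of_isPure_left (hf : Function.Injective f) (hg : Function.Injective g)
    {k : ℕ} (hα : IsUDA k α) (hβ : IsUDA k β) (hp : IsPure α) : IsUDA k (e.tensor α β) := by
  refine ⟨e.isState_tensor hα.1 hβ.1, fun σ hσ h => ?_⟩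
  have h1 : traceRight e.equiv σ = α := e.traceRight_eq_of_isUDA hf hα hβ.1 hσ h
  have h2 : traceLeft e.equiv σ = β :=
    e.symm.traceRight_eq_of_isUDA hg hβ hα.1 hσ (by rwa [symm_tensor])
  obtain ⟨hs, ψ, rfl⟩ := hp
  ext z z'
  have := apply_eq_of_traceRight_eq_proj e.equiv hσ.1 (sum_mul_star_eq_one hs) h1
    (e.equiv z).1 (e.equiv z').1 (e.equiv z).2 (e.equiv z').2
  rw [h2] at this
  simpa [tensor] using this

theorem isGenuinelyEntangled_tensor_of_isPure_left (hf : Function.Injective f)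
    (hfg : ∀ p, (∃ i, f i = p) ∨ ∃ j, g j = p) (hov : ∃ i j, f i = g j)
    (hα : IsGenuinelyEntangled α) (hβ : IsGenuinelyEntangled β) (hp : IsPure α) :
    IsGenuinelyEntangled (e.tensor α β) := by
  refine ⟨hα.1.trans (Fintype.card_le_of_injective f hf), e.isState_tensor hα.2.1 hβ.2.1,
    fun hmem => hβ.2.2 ?_⟩
  obtain ⟨hs, a, rfl⟩ := hp
  have ha := sum_mul_star_eq_one hs
  obtain ⟨K, _, w, σ, hw, hw1, hσ, hsum⟩ := mem_convexHull_iff_exists_fintype.1 hmem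
  choose hst φ hφ hφσ using hσ
  have happ : ∀ x x' y y', ∑ k, (w k : ℂ) * (φ k (e.equiv.symm (x, y)) *
      star (φ k (e.equiv.symm (x', y')))) = a x * star (a x') * β y y' := by
    intro x x' y y'
    have := congrFun (congrFun hsum (e.equiv.symm (x, y))) (e.equiv.symm (x', y'))
    simpa [Matrix.sum_apply, hφσ, proj, Matrix.vecMulVec_apply, tensor] using this
  have hsq : ∀ k, ((Real.sqrt (w k) : ℝ) : ℂ) * star ((Real.sqrt (w k) : ℝ) : ℂ) = w k :=
    fun k => by
      rw [Complex.star_def, Complex.conj_ofReal, ← Complex.ofReal_mul, Real.mul_self_sqrt (hw k)]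
  -- The weights enter the vectors as square roots, so that the `A`-marginal of the mixture is a
  -- plain sum of rank-one operators.
  have key := eq_mul_of_sum_mul_star_eq (K := K × (∀ j, B j)) ha
    (r := fun k x => ((Real.sqrt (w k.1) : ℝ) : ℂ) * φ k.1 (e.equiv.symm (x, k.2)))
    fun x x' => by
      rw [Fintype.sum_prod_type, Finset.sum_comm]
      calc _ = ∑ y, ∑ k, (w k : ℂ) * (φ k (e.equiv.symm (x, y)) *
              star (φ k (e.equiv.symm (x', y)))) := by
            refine Finset.sum_congr rfl fun y _ => Finset.sum_congr rfl fun k _ => ?_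
            rw [star_mul', ← hsq]
            ring
        _ = a x * star (a x') * β.trace := by
            simp only [happ, ← Finset.mul_sum]
            rfl
        _ = _ := by rw [hβ.2.1.2, mul_one]
  let b : K → (∀ j, B j) → ℂ := fun k y => ∑ x, star (a x) * φ k (e.equiv.symm (x, y))
  have hb : ∀ k, w k ≠ 0 → ∀ x y, φ k (e.equiv.symm (x, y)) = a x * b k y := by
    intro k hk x y
    have h0 : ((Real.sqrt (w k) : ℝ) : ℂ) ≠ 0 :=
      Complex.ofReal_ne_zero.2 (Real.sqrt_ne_zero'.2 ((hw k).lt_of_ne' hk))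
    refine mul_left_cancel₀ h0 ((key (k, y) x).trans ?_)
    simp only [b, Finset.mul_sum]
    exact Finset.sum_congr rfl fun x _ => by ring
  have hbt : ∀ k, w k ≠ 0 → traceLeft e.equiv (σ k) = proj (b k) := by
    intro k hk
    ext y y'
    rw [traceLeft_apply, hφσ]
    simp only [proj, Matrix.vecMulVec_apply, Pi.star_apply, hb k hk, star_mul']
    calc _ = (∑ x, a x * star (a x)) * (b k y * star (b k y')) := by
          rw [Finset.sum_mul]
          exact Finset.sum_congr rfl fun x _ => by ring
      _ = _ := by rw [ha, one_mul]
  have hβsum : β = ∑ k, w k • traceLeft e.equiv (σ k) := by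
    ext y y'
    rw [← e.traceLeft_tensor (β := β) hs.2, ← hsum]
    simp only [traceLeft_apply, Matrix.sum_apply, Matrix.smul_apply, Finset.smul_sum]
    exact Finset.sum_comm
  rw [hβsum, ← finsum_eq_sum_of_fintype]
  -- `finsum_mem` asks for membership only where the weight is nonzero, which is where `φ k = a ⊗ b
  -- k` is known.
  refine (convex_convexHull ℝ _).finsum_mem hw (by rw [finsum_eq_sum_of_fintype, hw1])
    fun k hk => subset_convexHull ℝ _ ?_
  have hbs : IsState (traceLeft e.equiv (σ k)) := e.symm.isState_traceRight (hst k)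
  refine ⟨hbs, b k, ?_, hbt k hk⟩
  refine (e.isBiproduct_or hfg hov (hφ k) (hb k hk) ?_ ?_).resolve_left fun hba =>
    hα.2.2 (subset_convexHull ℝ _ ⟨hs, a, hba, rfl⟩)
  · by_contra! h0
    simp [h0] at ha
  · by_contra! h0
    rw [hbt k hk] at hbs
    simpa [h0] using sum_mul_star_eq_one hbs

theorem isGenuinelyEntangled_and_isUDA_tensor (hf : Function.Injective f)
    (hg : Function.Injective g) (hfg : ∀ p, (∃ i, f i = p) ∨ ∃ j, g j = p)
    (hov : ∃ i j, f i = g j) {k : ℕ} (hα : IsUDA k α) (hβ : IsUDA k β)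
    (hα' : IsGenuinelyEntangled α) (hβ' : IsGenuinelyEntangled β)
    (hp : IsPure α ∨ IsPure β) :
    IsGenuinelyEntangled (e.tensor α β) ∧ IsUDA k (e.tensor α β) := by
  rcases hp with hp | hp
  · exact ⟨e.isGenuinelyEntangled_tensor_of_isPure_left hf hfg hov hα' hβ' hp,
      e.isUDA_tensor_of_isPure_left hf hg hα hβ hp⟩
  · rw [← symm_tensor]
    obtain ⟨i, j, h⟩ := hov
    exact ⟨e.symm.isGenuinelyEntangled_tensor_of_isPure_left hg (fun p => (hfg p).symm)
      ⟨j, i, h.symm⟩ hβ' hα' hp, e.symm.isUDA_tensor_of_isPure_left hg hf hβ hα hp⟩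

/-- Merging the parties of the joint system of `A` and `B` is a composition of the systems. -/
def ofMerge {ι κ π : Type} (F : ι ⊕ κ → π) (A : ι → Type u) (B : κ → Type u) :
    Composition (F ∘ Sum.inl) (F ∘ Sum.inr) A B (Merged F (Joint A B)) where
  equiv :=
    { toFun := fun z =>
        (fun i => z (F (.inl i)) ⟨.inl i, rfl⟩, fun j => z (F (.inr j)) ⟨.inr j, rfl⟩)
      invFun := fun xy _ t => match t with
        | ⟨.inl i, _⟩ => xy.1 i
        | ⟨.inr j, _⟩ => xy.2 j
      left_inv := fun z => by
        funext p t
        obtain ⟨i | j, rfl⟩ := t <;> rfl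
      right_inv := fun xy => rfl }
  apply_eq_iff z z' p := by
    refine ⟨fun h => ⟨?_, ?_⟩, fun h => ?_⟩
    · rintro i rfl
      exact congrFun h _
    · rintro j rfl
      exact congrFun h _
    · funext t
      obtain ⟨i | j, rfl⟩ := t
      · exact h.1 i rfl
      · exact h.2 j rfl

end Composition

end Multipartite

/-! ### The Kronecker and `K_c` groupings -/

theorem proposition1 {m n : ℕ} (k : ℕ)
    (A : Fin m → Type u) (B : Fin n → Type u) [∀ i, Fintype (A i)] [∀ j, Fintype (B j)]
    (α : Matrix (∀ i, A i) (∀ i, A i) ℂ) (β : Matrix (∀ j, B j) (∀ j, B j) ℂ)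
    (hα : Multipartite.IsUDA k α) (hβ : Multipartite.IsUDA k β)
    (hα' : Multipartite.IsGenuinelyEntangled α) (hβ' : Multipartite.IsGenuinelyEntangled β)
    (hpure : Multipartite.IsPure α ∨ Multipartite.IsPure β) :
    (Multipartite.IsGenuinelyEntangled (Multipartite.kron α β) ∧
      Multipartite.IsUDA k (Multipartite.kron α β)) ∧
    (∀ (l : ℕ) (hl : l < min m n), 1 ≤ l →
      Multipartite.IsGenuinelyEntangled (Multipartite.kc l hl α β) ∧
        Multipartite.IsUDA k (Multipartite.kc l hl α β)) := by
  have hm : 2 ≤ m := by simpa using hα'.1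
  have hn : 2 ≤ n := by simpa using hβ'.1
  refine ⟨?_, fun l hl hl1 => ?_⟩
  · refine (Multipartite.Composition.ofMerge (Multipartite.kronParty m n) A B
      ).isGenuinelyEntangled_and_isUDA_tensor ?_ ?_ (fun p => ?_)
      ⟨⟨0, by omega⟩, ⟨0, by omega⟩, rfl⟩ hα hβ hα' hβ' hpure
    · exact Fin.castLE_injective (le_max_left m n)
    · exact Fin.castLE_injective (le_max_right m n)
    · by_cases hp : (p : ℕ) < m
      · exact .inl ⟨⟨p, hp⟩, rfl⟩
      · exact .inr ⟨⟨p, by have := p.2; omega⟩, rfl⟩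
  · refine (Multipartite.Composition.ofMerge (Multipartite.kcParty m n l hl) A B
      ).isGenuinelyEntangled_and_isUDA_tensor ?_ ?_ (fun p => ?_)
      ⟨⟨0, by omega⟩, ⟨0, by omega⟩, ?_⟩ hα hβ hα' hβ' hpure
    · intro i i' h
      simpa [Multipartite.kcParty, Fin.ext_iff] using h
    · intro j j' h
      simp only [Multipartite.kcParty, Function.comp_apply] at h
      split_ifs at h <;> simp only [Fin.mk.injEq] at h <;> ext <;> omega
    · by_cases hp : (p : ℕ) < m
      · exact .inl ⟨⟨p, hp⟩, rfl⟩
      -- Positions from `m` on hold the uncomposed parties of `B`, whose indices start at `l`.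
      · refine .inr ⟨⟨p - m + l, by have := p.2; omega⟩, ?_⟩
        have : ¬ (p : ℕ) - m + l < l := by omega
        simp only [Multipartite.kcParty, Function.comp_apply, this, if_false, Fin.ext_iff]
        omega
    · have : 0 < l := hl1
      simp [Multipartite.kcParty, this]
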